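/- Let $K$ be a field and let $A$ be a finite-dimensional (associative, unital) $K$-algebra. Modules are left $A$-modules. An $A$-module $M$ is *distributive* if its lattice of submodules is distributive, i.e. $X\cap(Y+Z)=(X\cap Y)+(X\cap Z)$ for all submodules $X,Y,Z$ of $M$; it is *thin* if it is finite-dimensional and no simple $A$-module occurs (up to isomorphism) more than once as a factor in a composition series of $M$; and it is *indecomposable* if it is nonzero and is not the direct sum of two nonzero submodules. The algebra $A$ is *acyclic* if its Ext quiver, whose vertices are the simple $A$-modules up to isomorphism, with an arrow from $S$ to $T$ whenever $\operatorname{Ext}^1_A(S,T)\neq 0$, has no oriented cycles. The *accessible* modules are defined inductively: every simple module is accessible, and an indecomposable module of finite length $n\ge 2$ is accessible if it has an accessible submodule of length $n-1$ or an accessible quotient module of length $n-1$. Let $M$ be an indecomposable $A$-module. 1. If $A$ is acyclic and $M$ is distributive, then $M$ is accessible. 2. If $M$ is thin (and $A$ is an arbitrary finite-dimensional algebra), then $M$ is accessible. -/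

import Mathlib

open CategoryTheory

universe u v

/-- A left module is distributive if its lattice of submodules is distributive. -/
def IsDistributiveModule (A : Type u) [Ring A] (M : Type v) [AddCommGroup M] [Module A M] : Prop :=
  ∀ X Y Z : Submodule A M, X ⊓ (Y ⊔ Z) = (X ⊓ Y) ⊔ (X ⊓ Z)

/-- A left module is indecomposable if it is nonzero and it is not the direct sum of two nonzero
submodules. -/
def IsIndecomposableModule (A : Type u) [Ring A] (M : Type v) [AddCommGroup M] [Module A M] :
    Prop :=
  Nontrivial M ∧ ∀ X Y : Submodule A M, IsCompl X Y → X = ⊥ ∨ Y = ⊥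

/-- The `i`-th factor of a composition series of submodules. -/
abbrev CompositionSeries.Factor {A : Type u} [Ring A] {M : Type v} [AddCommGroup M] [Module A M]
    (s : CompositionSeries (Submodule A M)) (i : Fin s.length) : Type v :=
  (s i.succ) ⧸ (s i.castSucc).comap (s i.succ).subtype

/-- A module of finite length is thin (or squarefree) if no simple module occurs more than once,
up to isomorphism, among the factors of a composition series of the module. (By the
Jordan-Hölder theorem it does not matter which composition series is used.) -/
def IsThinModule (A : Type u) [Ring A] (M : Type v) [AddCommGroup M] [Module A M] : Prop :=
  IsFiniteLength A M ∧
    ∀ s : CompositionSeries (Submodule A M), s.head = ⊥ → s.last = ⊤ →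
      ∀ i j : Fin s.length, Nonempty (s.Factor i ≃ₗ[A] s.Factor j) → i = j

/-- The simple left modules over `A`. Every simple left `A`-module is isomorphic to a quotient
of `A`, so that the universe of `A` contains all of them up to isomorphism. -/
def SimpleModules (A : Type u) [Ring A] : Type (u + 1) :=
  {S : ModuleCat.{u} A // IsSimpleModule A S}

/-- The arrows of the Ext quiver: there is an arrow from `S` to `T` when `Ext¹(S, T) ≠ 0`. -/
def ExtArrow (A : Type u) [Ring A] (S T : SimpleModules A) : Prop :=
  Nontrivial (Abelian.Ext S.1 T.1 1)

/-- A ring is acyclic if its Ext quiver has no oriented cycle (in particular no loop). The vertices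
are simple modules rather than isomorphism classes of them; as `Ext¹` depends only on isomorphism
classes, this does not affect the existence of oriented cycles. -/
def IsAcyclicAlgebra (A : Type u) [Ring A] : Prop :=
  ∀ S : SimpleModules A, ¬ Relation.TransGen (ExtArrow A) S S

/-- Accessible modules, defined inductively: simple modules are accessible, and an indecomposable
module of length `n + 1` is accessible if it has an accessible submodule or an accessible quotient
module of length `n`. -/
inductive IsAccessibleModule (A : Type u) [Ring A] :
    ∀ (M : Type v) [AddCommGroup M] [Module A M], Prop
  | simple (M : Type v) [AddCommGroup M] [Module A M] (hM : IsSimpleModule A M) :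
      IsAccessibleModule A M
  | of_submodule (M : Type v) [AddCommGroup M] [Module A M] (n : ℕ) (N : Submodule A M)
      (hM : IsIndecomposableModule A M) (hlM : Module.length A M = (n + 1 : ℕ))
      (hlN : Module.length A N = n) (hN : IsAccessibleModule A N) :
      IsAccessibleModule A M
  | of_quotient (M : Type v) [AddCommGroup M] [Module A M] (n : ℕ) (N : Submodule A M)
      (hM : IsIndecomposableModule A M) (hlM : Module.length A M = (n + 1 : ℕ))
      (hlN : Module.length A (M ⧸ N) = n) (hN : IsAccessibleModule A (M ⧸ N)) :
      IsAccessibleModule A M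

/-! ### Connectedness of finite posets and sup-irreducible elements -/

section Order

/-! A finite-length distributive submodule lattice is governed, as in Birkhoff's theorem, by its
finite poset of sup-irreducible elements, which are sup-prime. A comparability-closed set of these
and its complement have complementary joins, so an indecomposable module gives a connected poset. If
this poset has at least two elements, an extremal one can be removed without disconnecting it
(`exists_extremal_comparabilityClosed`). A minimal one is a simple submodule with indecomposable
quotient; for a maximal one, the join of the others is a maximal submodule that is indecomposable.
Induction on length finishes the proof.

It remains to see that distributive modules over an Artinian ring have finite length
(`IsDistributiveModule.isFiniteLength`), and that thin modules are distributive because their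
sup-irreducible submodules are sup-prime (`IsThinModule.supPrime`). -/

/-- A set of elements of a poset, no member of which is comparable to a non-member, as far as
elements outside `T` are concerned. -/
def IsComparabilityClosed {P : Type*} [LE P] (T S : Set P) : Prop :=
  ∀ p q, p ∉ T → q ∉ T → p ≤ q → (p ∈ S ↔ q ∈ S)

lemma exists_isMin_le {P : Type*} [PartialOrder P] [Finite P] (p : P) : ∃ m ≤ p, IsMin m := by
  obtain ⟨m, hm, h⟩ := exists_minimal_le_of_wellFoundedLT (fun _ : P ↦ True) p trivial
  exact ⟨m, hm, by simpa using h⟩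

lemma exists_le_isMax {P : Type*} [PartialOrder P] [Finite P] (p : P) : ∃ m, p ≤ m ∧ IsMax m := by
  obtain ⟨m, hm, h⟩ := exists_maximal_ge_of_wellFoundedGT (fun _ : P ↦ True) p trivial
  exact ⟨m, hm, by simpa using h⟩

/-- The comparability graph on the extremal (minimal or maximal) elements of a poset. -/
def extremalGraph (P : Type*) [PartialOrder P] : SimpleGraph {p : P // IsMin p ∨ IsMax p} :=
  SimpleGraph.fromRel fun a b ↦ a.1 ≤ b.1

lemma extremalGraph_reachable_of_le {P : Type*} [PartialOrder P]
    {a b : {p : P // IsMin p ∨ IsMax p}} (h : a.1 ≤ b.1) : (extremalGraph P).Reachable a b := by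
  by_cases hab : a = b
  · exact hab ▸ SimpleGraph.Reachable.refl _
  · exact SimpleGraph.Adj.reachable
      ((SimpleGraph.fromRel_adj _ _ _).2 ⟨hab, Or.inl h⟩)

/-- Every element lies between a minimal and a maximal one, so the elements comparable to a
connected component of extremal ones form a comparability-closed set. -/
lemma extremalGraph_connected {P : Type*} [PartialOrder P] [Finite P] [Nonempty P]
    (h : ∀ S : Set P, IsComparabilityClosed ∅ S → S = ∅ ∨ S = Set.univ) :
    (extremalGraph P).Connected := by
  obtain ⟨m, -, hm⟩ := exists_isMin_le (Classical.arbitrary P)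
  have : Nonempty {p : P // IsMin p ∨ IsMax p} := ⟨⟨m, Or.inl hm⟩⟩
  refine SimpleGraph.Connected.mk fun v w ↦ ?_
  let S : Set P := {p | ∃ e : {p : P // IsMin p ∨ IsMax p}, (extremalGraph P).Reachable v e ∧
    (e.1 ≤ p ∨ p ≤ e.1)}
  have below : ∀ p ∈ S, ∀ m : {p : P // IsMin p ∨ IsMax p}, (m.1 ≤ p ∨ p ≤ m.1) →
      (extremalGraph P).Reachable v m := by
    rintro p ⟨e, he, hep⟩ m hmp
    obtain ⟨b, hb, hb'⟩ := exists_isMin_le p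
    obtain ⟨t, ht, ht'⟩ := exists_le_isMax p
    have hbt := extremalGraph_reachable_of_le
      (a := ⟨b, Or.inl hb'⟩) (b := ⟨t, Or.inr ht'⟩) (hb.trans ht)
    have key : ∀ x : {p : P // IsMin p ∨ IsMax p}, (x.1 ≤ p ∨ p ≤ x.1) →
        (extremalGraph P).Reachable x ⟨t, Or.inr ht'⟩ := by
      rintro x (hx | hx)
      · exact extremalGraph_reachable_of_le (hx.trans ht)
      · exact (extremalGraph_reachable_of_le (a := ⟨b, Or.inl hb'⟩) (hb.trans hx)).symm.trans hbt
    exact (he.trans (key e hep)).trans (key m hmp).symm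
  have hS : IsComparabilityClosed ∅ S := by
    intro p q _ _ hpq
    constructor
    · intro hp
      obtain ⟨b, hb, hb'⟩ := exists_isMin_le p
      exact ⟨⟨b, Or.inl hb'⟩, below p hp _ (Or.inl hb), Or.inl (hb.trans hpq)⟩
    · intro hq
      obtain ⟨t, ht, ht'⟩ := exists_le_isMax q
      exact ⟨⟨t, Or.inr ht'⟩, below q hq _ (Or.inr ht), Or.inr (hpq.trans ht)⟩
  have hv : v.1 ∈ S := ⟨v, SimpleGraph.Reachable.refl _, Or.inl le_rfl⟩
  rcases h S hS with h0 | h1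
  · exact absurd hv (h0 ▸ Set.notMem_empty _)
  · exact below w.1 (h1 ▸ Set.mem_univ _) w (Or.inl le_rfl)

/-- A finite connected poset with at least two elements has a minimal or maximal element whose
removal leaves it connected. -/
lemma exists_extremal_comparabilityClosed {P : Type*} [PartialOrder P] [Finite P] [Nontrivial P]
    (h : ∀ S : Set P, IsComparabilityClosed ∅ S → S = ∅ ∨ S = Set.univ) :
    ∃ x : P, (IsMin x ∨ IsMax x) ∧ ∀ S : Set P, IsComparabilityClosed {x} S →
      (∀ p ≠ x, p ∈ S) ∨ ∀ p ≠ x, p ∉ S := by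
  -- A finite connected graph has a vertex that does not disconnect it. Using only extremal elements
  -- as vertices forces this vertex to be extremal.
  obtain ⟨x, hx⟩ :=
    (extremalGraph_connected h).exists_preconnected_induce_compl_singleton_of_finite
  refine ⟨x.1, x.2, fun S hS ↦ ?_⟩
  have hmem : ∀ e f : {p : P // IsMin p ∨ IsMax p}, e ≠ x → f ≠ x → (e.1 ∈ S ↔ f.1 ∈ S) := by
    intro e f he hf
    have hr := (SimpleGraph.reachable_iff_reflTransGen _ _).1 (hx ⟨e, he⟩ ⟨f, hf⟩)
    have : ∀ g, Relation.ReflTransGen ((extremalGraph P).induce {x}ᶜ).Adj ⟨e, he⟩ g →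
        (e.1 ∈ S ↔ g.1.1 ∈ S) := by
      intro g hg
      induction hg with
      | refl => rfl
      | @tail b c _ hbc ih =>
        rw [ih]
        have hb : b.1.1 ≠ x.1 := fun hb ↦ b.2 (Subtype.ext hb)
        have hc : c.1.1 ≠ x.1 := fun hc ↦ c.2 (Subtype.ext hc)
        rcases ((SimpleGraph.fromRel_adj (fun a b : {p : P // IsMin p ∨ IsMax p} ↦ a.1 ≤ b.1)
          b.1 c.1).1 hbc).2 with hle | hle
        · exact hS _ _ hb hc hle
        · exact (hS _ _ hc hb hle).symm
    exact this _ hr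
  have hnot : ¬ (IsMin x.1 ∧ IsMax x.1) := by
    rintro ⟨h1, h2⟩
    rcases h {x.1} (by
      intro p q _ _ hpq
      constructor
      · rintro rfl; exact (h2.eq_of_le hpq).symm
      · rintro rfl; exact h1.eq_of_le hpq) with h0 | h0
    · exact Set.singleton_ne_empty _ h0
    · obtain ⟨y, hy⟩ := exists_ne x.1
      exact hy ((Set.ext_iff.1 h0 y).2 trivial)
  -- Going away from `x`, upwards if `x` is minimal and downwards if it is maximal, leads from `p`
  -- to an extremal element other than `x`.
  have hext : ∀ p ≠ x.1, ∃ e : {p : P // IsMin p ∨ IsMax p}, e ≠ x ∧ (p ∈ S ↔ e.1 ∈ S) := by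
    intro p hp
    rcases x.2 with hmin | hmax
    · obtain ⟨t, ht, ht'⟩ := exists_le_isMax p
      have htx : t ≠ x.1 := fun h' ↦ hnot ⟨hmin, h' ▸ ht'⟩
      exact ⟨⟨t, Or.inr ht'⟩, fun h' ↦ htx (congrArg Subtype.val h'), hS _ _ hp htx ht⟩
    · obtain ⟨t, ht, ht'⟩ := exists_isMin_le p
      have htx : t ≠ x.1 := fun h' ↦ hnot ⟨h' ▸ ht', hmax⟩
      exact ⟨⟨t, Or.inl ht'⟩, fun h' ↦ htx (congrArg Subtype.val h'), (hS _ _ htx hp ht).symm⟩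
  by_contra! hcon
  obtain ⟨⟨p, hp, hpS⟩, q, hq, hqS⟩ := hcon
  obtain ⟨e, he, hpe⟩ := hext p hp
  obtain ⟨f, hf, hqf⟩ := hext q hq
  exact hpS (hpe.2 ((hmem e f he hf).2 (hqf.1 hqS)))

variable {L : Type*} [Lattice L] [BoundedOrder L]

lemma le_iff_forall_supIrred_le [WellFoundedLT L] {a b : L} :
    a ≤ b ↔ ∀ p, SupIrred p → p ≤ a → p ≤ b := by
  refine ⟨fun h p _ hp ↦ hp.trans h, fun h ↦ ?_⟩
  obtain ⟨s, rfl, hs⟩ := exists_supIrred_decomposition a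
  exact Finset.sup_le fun p hp ↦ h p (hs hp) (Finset.le_sup (f := id) hp)

/-- Each sup-prime is sent to the first term of a maximal chain lying above it. If `p` and `q` first
appear at `a (k + 1)`, then `p ≤ a k ⊔ q`, so `p ≤ q` by primality, and conversely. -/
lemma finite_supPrime [WellFoundedLT L] [WellFoundedGT L] : Finite {p : L // SupPrime p} := by
  classical
  obtain ⟨a, h0, n, hn, hcov⟩ := exists_covBy_seq_of_wellFoundedLT_wellFoundedGT L
  have hex : ∀ p : L, ∃ i, p ≤ a i := fun p ↦ ⟨n, hn.eq_top ▸ le_top⟩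
  have key : ∀ p q : L, SupPrime p → SupPrime q → Nat.find (hex p) = Nat.find (hex q) →
      p ≤ q := by
    intro p q hp hq heq
    have hp1 := Nat.find_spec (hex p)
    have hq1 := Nat.find_spec (hex q)
    have hle : Nat.find (hex p) ≤ n := Nat.find_min' _ (hn.eq_top ▸ le_top)
    rcases hk : Nat.find (hex p) with _ | k
    · rw [hk, h0.eq_bot] at hp1
      exact absurd (le_bot_iff.1 hp1) hp.ne_bot
    · rw [← heq] at hq1
      rw [hk] at hp1 hq1 hle
      have hp2 : ¬ p ≤ a k := Nat.find_min (hex p) (by lia)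
      have hq2 : ¬ q ≤ a k := Nat.find_min (hex q) (by lia)
      have hc := hcov k (by lia)
      have : a k ⊔ q = a (k + 1) :=
        (hc.eq_or_eq le_sup_left (sup_le hc.le hq1)).resolve_left (by simpa using hq2)
      exact (hp.2 (this ▸ hp1 : p ≤ a k ⊔ q)).resolve_left hp2
  refine Finite.of_injective
    (fun p : {p : L // SupPrime p} ↦ (⟨Nat.find (hex p.1), Nat.lt_succ_of_le
      (Nat.find_min' _ (hn.eq_top ▸ le_top))⟩ : Fin (n + 1))) fun p q hpq ↦ ?_
  have := congrArg Fin.val hpq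
  exact Subtype.ext (le_antisymm (key _ _ p.2 q.2 this) (key _ _ q.2 p.2 this.symm))

/-- In an indecomposable lattice of finite height with enough sup-primes, some atom or coatom can
be split off such that the remaining interval is again indecomposable. -/
lemma exists_isAtom_or_isCoatom_of_indecomposable [WellFoundedLT L] [WellFoundedGT L]
    (hprime : ∀ p : L, SupIrred p → SupPrime p) (hnt : Nontrivial {p : L // SupIrred p})
    (hind : ∀ x y : L, IsCompl x y → x = ⊥ ∨ y = ⊥) :
    (∃ a : L, IsAtom a ∧ ∀ x y, x ⊓ y = a → x ⊔ y = ⊤ → x = a ∨ y = a) ∨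
      ∃ c : L, IsCoatom c ∧ ∀ x y, x ⊓ y = ⊥ → x ⊔ y = c → x = ⊥ ∨ y = ⊥ := by
  classical
  have hfin : Finite {p : L // SupIrred p} := by
    have := finite_supPrime (L := L)
    exact Finite.of_injective (fun p : {p : L // SupIrred p} ↦
      (⟨p.1, hprime _ p.2⟩ : {p : L // SupPrime p})) fun p q h ↦
        Subtype.ext (congrArg (fun x : {p : L // SupPrime p} ↦ x.1) h)
  have := Fintype.ofFinite {p : L // SupIrred p}
  have hbot : ∀ x : L, (∀ p : {p : L // SupIrred p}, ¬ p.1 ≤ x) → x = ⊥ := fun x hx ↦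
    le_bot_iff.1 (le_iff_forall_supIrred_le.2 fun p hp hpx ↦ (hx ⟨p, hp⟩ hpx).elim)
  have hconn : ∀ S : Set {p : L // SupIrred p}, IsComparabilityClosed ∅ S →
      S = ∅ ∨ S = Set.univ := by
    intro S hS
    set X : L := (Finset.univ.filter (· ∈ S)).sup (fun p ↦ p.1) with hX
    set Y : L := (Finset.univ.filter (· ∉ S)).sup (fun p ↦ p.1) with hY
    have hpX : ∀ p : {p : L // SupIrred p}, p.1 ≤ X ↔ p ∈ S := by
      intro p
      rw [hX, (hprime _ p.2).le_finset_sup]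
      constructor
      · rintro ⟨q, hq, hpq⟩
        exact (hS p q (by simp) (by simp) hpq).2 (by simpa using hq)
      · exact fun hp ↦ ⟨p, by simpa using hp, le_rfl⟩
    have hpY : ∀ p : {p : L // SupIrred p}, p.1 ≤ Y ↔ p ∉ S := by
      intro p
      rw [hY, (hprime _ p.2).le_finset_sup]
      constructor
      · rintro ⟨q, hq, hpq⟩ hp
        exact (Finset.mem_filter.1 hq).2 ((hS p q (by simp) (by simp) hpq).1 hp)
      · exact fun hp ↦ ⟨p, by simpa using hp, le_rfl⟩
    have hc : IsCompl X Y := by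
      constructor
      · rw [disjoint_iff]
        exact hbot _ fun p hp ↦ (hpY p).1 (hp.trans inf_le_right) ((hpX p).1 (hp.trans inf_le_left))
      · rw [codisjoint_iff, eq_top_iff]
        refine le_iff_forall_supIrred_le.2 fun p hp _ ↦ ?_
        by_cases hpS : (⟨p, hp⟩ : {p : L // SupIrred p}) ∈ S
        · exact ((hpX ⟨p, hp⟩).2 hpS).trans le_sup_left
        · exact ((hpY ⟨p, hp⟩).2 hpS).trans le_sup_right
    rcases hind X Y hc with h | h
    · left
      refine Set.eq_empty_iff_forall_notMem.2 fun p hp ↦ p.2.ne_bot ?_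
      exact le_bot_iff.1 (h ▸ (hpX p).2 hp)
    · right
      refine Set.eq_univ_iff_forall.2 fun p ↦ ?_
      by_contra hp
      exact p.2.ne_bot (le_bot_iff.1 (h ▸ (hpY p).2 hp))
  obtain ⟨x, hx, hrem⟩ := exists_extremal_comparabilityClosed hconn
  rcases hx with hmin | hmax
  · left
    have hatom : IsAtom x.1 := by
      refine ⟨x.2.ne_bot, fun b hb ↦ hbot _ fun p hp ↦ ?_⟩
      have h1 : p ≤ x := hp.trans hb.le
      have h2 : x.1 ≤ p.1 := hmin h1
      exact absurd (h2.trans hp) hb.not_ge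
    refine ⟨x.1, hatom, fun X Y hXY hXY' ↦ ?_⟩
    have hle : ∀ p : {p : L // SupIrred p}, p.1 ≤ X ∨ p.1 ≤ Y := fun p ↦
      (hprime _ p.2).2 (hXY' ▸ le_top)
    have hnot : ∀ p ≠ x, ¬ (p.1 ≤ X ∧ p.1 ≤ Y) := fun p hp h ↦
      hp (Subtype.ext ((hatom.le_iff.1 (hXY ▸ le_inf h.1 h.2)).resolve_left p.2.ne_bot))
    -- If `p ≤ q` with `p ≤ X` and `q ≤ Y`, then `p` lies below `X ⊓ Y = x`, which only `x` does.
    have hcl : IsComparabilityClosed {x} {p : {p : L // SupIrred p} | p.1 ≤ X} := by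
      intro p q hp hq hpq
      refine ⟨fun h ↦ (hle q).resolve_right fun h' ↦ hnot p hp ⟨h, le_trans hpq h'⟩,
        fun h ↦ le_trans hpq h⟩
    rcases hrem _ hcl with h | h
    · right
      refine le_antisymm ?_ (hXY ▸ inf_le_right)
      refine le_iff_forall_supIrred_le.2 fun p hp hpY ↦ ?_
      by_cases hpx : (⟨p, hp⟩ : {p : L // SupIrred p}) = x
      · exact hpx ▸ le_rfl
      · exact (hnot _ hpx ⟨h _ hpx, hpY⟩).elim
    · left
      refine le_antisymm ?_ (hXY ▸ inf_le_left)
      refine le_iff_forall_supIrred_le.2 fun p hp hpX ↦ ?_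
      by_cases hpx : (⟨p, hp⟩ : {p : L // SupIrred p}) = x
      · exact hpx ▸ le_rfl
      · exact (h _ hpx hpX).elim
  · right
    -- Since `x` is sup-prime and maximal, it is not below the join of the others.
    set c : L := (Finset.univ.filter (· ≠ x)).sup (fun p ↦ p.1) with hc
    have hpc : ∀ p : {p : L // SupIrred p}, p.1 ≤ c ↔ p ≠ x := by
      intro p
      rw [hc, (hprime _ p.2).le_finset_sup]
      constructor
      · rintro ⟨q, hq, hpq⟩ rfl
        exact (Finset.mem_filter.1 hq).2 (hmax.eq_of_le hpq).symm
      · exact fun hp ↦ ⟨p, by simpa using hp, le_rfl⟩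
    have hcoatom : IsCoatom c := by
      refine ⟨fun h ↦ (hpc x).1 (h ▸ le_top) rfl, fun d hd ↦ ?_⟩
      have hxd : x.1 ≤ d := by
        by_contra hxd
        refine hd.not_ge (le_iff_forall_supIrred_le.2 fun p hp hpd ↦ ?_)
        refine (hpc ⟨p, hp⟩).2 ?_
        rintro rfl
        exact hxd hpd
      refine eq_top_iff.2 (le_iff_forall_supIrred_le.2 fun p hp _ ↦ ?_)
      by_cases hpx : (⟨p, hp⟩ : {p : L // SupIrred p}) = x
      · exact (congrArg Subtype.val hpx).trans_le hxd
      · exact ((hpc ⟨p, hp⟩).2 hpx).trans hd.le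
    refine ⟨c, hcoatom, fun X Y hXY hXY' ↦ ?_⟩
    have hle : ∀ p ≠ x, p.1 ≤ X ∨ p.1 ≤ Y := fun p hp ↦
      (hprime _ p.2).2 (hXY' ▸ (hpc p).2 hp)
    have hnot : ∀ p : {p : L // SupIrred p}, ¬ (p.1 ≤ X ∧ p.1 ≤ Y) := fun p h ↦
      p.2.ne_bot (le_bot_iff.1 (hXY ▸ le_inf h.1 h.2))
    have hcl : IsComparabilityClosed {x} {p : {p : L // SupIrred p} | p.1 ≤ X} := by
      intro p q hp hq hpq
      refine ⟨fun h ↦ (hle q hq).resolve_right fun h' ↦ hnot p ⟨h, le_trans hpq h'⟩,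
        fun h ↦ le_trans hpq h⟩
    rcases hrem _ hcl with h | h
    · right
      refine hbot _ fun p hpY ↦ hnot p ⟨h p ?_, hpY⟩
      exact (hpc p).1 (hpY.trans (hXY' ▸ le_sup_right))
    · left
      refine hbot _ fun p hpX ↦ h p ?_ hpX
      exact (hpc p).1 (hpX.trans (hXY' ▸ le_sup_left))

end Order

/-! ### Distributive modules: subquotients and simple submodules -/

section Distributive

variable {A : Type u} [Ring A] {M : Type v} [AddCommGroup M] [Module A M]

lemma IsDistributiveModule.of_injective {N : Type*} [AddCommGroup N] [Module A N]
    (h : IsDistributiveModule A M) (f : N →ₗ[A] M) (hf : Function.Injective f) :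
    IsDistributiveModule A N := by
  intro X Y Z
  apply Submodule.map_injective_of_injective hf
  simp only [Submodule.map_inf _ hf, Submodule.map_sup]
  exact h _ _ _

lemma comap_sup_of_surjective {N : Type*} [AddCommGroup N] [Module A N] {f : M →ₗ[A] N}
    (hf : Function.Surjective f) (X Y : Submodule A N) :
    (X ⊔ Y).comap f = X.comap f ⊔ Y.comap f := by
  rw [← Submodule.map_comap_eq_of_surjective hf X, ← Submodule.map_comap_eq_of_surjective hf Y,
    ← Submodule.map_sup, Submodule.comap_map_eq, Submodule.map_comap_eq_of_surjective hf,
    Submodule.map_comap_eq_of_surjective hf]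
  exact sup_eq_left.2 (le_sup_of_le_left (LinearMap.ker_le_comap f))

lemma IsDistributiveModule.of_surjective {N : Type*} [AddCommGroup N] [Module A N]
    (h : IsDistributiveModule A M) (f : M →ₗ[A] N) (hf : Function.Surjective f) :
    IsDistributiveModule A N := by
  intro X Y Z
  apply Submodule.comap_injective_of_surjective hf
  simp only [Submodule.comap_inf, comap_sup_of_surjective hf]
  exact h _ _ _

lemma IsDistributiveModule.supPrime (h : IsDistributiveModule A M) {p : Submodule A M}
    (hp : SupIrred p) : SupPrime p := by
  refine ⟨hp.1, fun X Y hXY ↦ ?_⟩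
  have := h p X Y
  rw [inf_eq_left.2 hXY] at this
  exact (hp.2 this.symm).imp inf_eq_left.1 inf_eq_left.1

/-- Otherwise the graph `D` of the isomorphism lies in `S ⊔ T` and meets `S` and `T` trivially, so
distributivity gives `D = ⊥`. -/
lemma IsDistributiveModule.eq_of_linearEquiv (h : IsDistributiveModule A M) {S T : Submodule A M}
    [IsSimpleModule A S] [IsSimpleModule A T] (e : S ≃ₗ[A] T) : S = T := by
  have hS := isSimpleModule_iff_isAtom.1 (inferInstance : IsSimpleModule A S)
  have hT := isSimpleModule_iff_isAtom.1 (inferInstance : IsSimpleModule A T)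
  by_contra hne
  have hd : S ⊓ T = ⊥ := disjoint_iff.1 (hS.disjoint_of_ne hT hne)
  have hmem : ∀ x ∈ S, x ∈ T → x = 0 := fun x hx hx' ↦ by
    simpa [hd] using Submodule.mem_inf.2 ⟨hx, hx'⟩
  set D : Submodule A M := LinearMap.range (S.subtype + T.subtype ∘ₗ e.toLinearMap) with hD
  have hDmem : ∀ x ∈ D, ∃ s : S, (s : M) + e s = x := by
    rintro x ⟨s, rfl⟩
    exact ⟨s, rfl⟩
  have hle : D ≤ S ⊔ T := by
    intro x hx
    obtain ⟨s, rfl⟩ := hDmem x hx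
    exact Submodule.add_mem_sup s.2 (e s).2
  have hDS : D ⊓ S = ⊥ := by
    refine (Submodule.eq_bot_iff _).2 fun x hx ↦ ?_
    obtain ⟨s, rfl⟩ := hDmem x hx.1
    have h1 : ((e s : T) : M) = 0 := hmem _ ((Submodule.add_mem_iff_right _ s.2).1 hx.2) (e s).2
    have h2 : s = 0 := by simpa using h1
    simp [h2]
  have hDT : D ⊓ T = ⊥ := by
    refine (Submodule.eq_bot_iff _).2 fun x hx ↦ ?_
    obtain ⟨s, rfl⟩ := hDmem x hx.1
    have h1 : (s : M) = 0 := hmem _ s.2 ((Submodule.add_mem_iff_left _ (e s).2).1 hx.2)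
    have h2 : s = 0 := by simpa using h1
    simp [h2]
  have hDbot : D = ⊥ := by
    have := h D S T
    rwa [inf_eq_left.2 hle, hDS, hDT, sup_bot_eq] at this
  have := IsSimpleModule.nontrivial A S
  obtain ⟨s, hs⟩ := exists_ne (0 : S)
  refine hs ?_
  have hs0 : (s : M) + e s = 0 := by
    have : (s : M) + e s ∈ D := ⟨s, rfl⟩
    simpa [hDbot] using this
  have : (s : M) = 0 := hmem _ s.2 (by rw [eq_neg_of_add_eq_zero_left hs0]; exact T.neg_mem (e s).2)
  simpa using this

end Distributive

/-! ### Locating simple modules among composition factors -/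

section Factors

variable {A : Type u} [Ring A]

lemma nonempty_linearEquiv_of_ker_le {U S T : Type*} [AddCommGroup U] [Module A U]
    [AddCommGroup S] [Module A S] [IsSimpleModule A S]
    [AddCommGroup T] [Module A T] [IsSimpleModule A T]
    (f : U →ₗ[A] S) (g : U →ₗ[A] T) (hg : g ≠ 0) (hfg : LinearMap.ker f ≤ LinearMap.ker g) :
    Nonempty (S ≃ₗ[A] T) := by
  have hf : f ≠ 0 := by
    rintro rfl
    rw [LinearMap.ker_zero, top_le_iff, LinearMap.ker_eq_top] at hfg
    exact hg hfg
  have hf' := LinearMap.surjective_of_ne_zero hf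
  have hg' := LinearMap.surjective_of_ne_zero hg
  have hker : LinearMap.ker f = LinearMap.ker g :=
    ((LinearMap.isCoatom_ker_of_surjective hf').le_iff.1 hfg).resolve_left
      (LinearMap.isCoatom_ker_of_surjective hg').1 |>.symm
  exact ⟨(f.quotKerEquivOfSurjective hf').symm ≪≫ₗ Submodule.quotEquivOfEq _ _ hker ≪≫ₗ
    g.quotKerEquivOfSurjective hg'⟩

variable {M : Type v} [AddCommGroup M] [Module A M]

lemma CompositionSeries.isSimpleModule_factor (s : CompositionSeries (Submodule A M))
    (i : Fin s.length) : IsSimpleModule A (s.Factor i) :=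
  (covBy_iff_quot_is_simple (s.step i).le).1 (s.step i)

/-- A nonzero map from a subquotient of `s b / s a` to a simple module exhibits this simple module
as one of the factors of `s` between `a` and `b`. -/
lemma CompositionSeries.exists_factor_linearEquiv (s : CompositionSeries (Submodule A M))
    {S : Type*} [AddCommGroup S] [Module A S] [IsSimpleModule A S] (N : Submodule A M)
    (g : N →ₗ[A] S) (hg : g ≠ 0) (a b : Fin (s.length + 1)) (hb : N ≤ s b)
    (ha : ∀ x : N, (x : M) ∈ s a → g x = 0) :
    ∃ i : Fin s.length, a ≤ i.castSucc ∧ i.succ ≤ b ∧ Nonempty (s.Factor i ≃ₗ[A] S) := by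
  have hmono : Monotone s := s.strictMono.monotone
  -- The factor sought is at the first step of the series where `g` stops vanishing.
  have key : ∀ j : Fin (s.length + 1), (∃ x : N, (x : M) ∈ s j ∧ g x ≠ 0) →
      ∃ i : Fin s.length, i.succ ≤ j ∧ (∀ x : N, (x : M) ∈ s i.castSucc → g x = 0) ∧
        ∃ x : N, (x : M) ∈ s i.succ ∧ g x ≠ 0 := by
    intro j
    induction j using Fin.induction with
    | zero =>
      rintro ⟨x, hx, hgx⟩
      exact (hgx (ha x (hmono (Fin.zero_le a) hx))).elim
    | succ i ih =>
      intro h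
      by_cases hi : ∃ x : N, (x : M) ∈ s i.castSucc ∧ g x ≠ 0
      · obtain ⟨k, hk, hk'⟩ := ih hi
        exact ⟨k, hk.trans (Fin.castSucc_lt_succ).le, hk'⟩
      · push Not at hi
        exact ⟨i, le_rfl, hi, h⟩
  obtain ⟨x, hx⟩ : ∃ x, g x ≠ 0 := by
    by_contra! h
    exact hg (LinearMap.ext h)
  obtain ⟨i, hib, hi, y, hy, hgy⟩ := key b ⟨x, hb x.2, hx⟩
  refine ⟨i, ?_, hib, ?_⟩
  · by_contra hlt
    exact hgy (ha y (hmono (Fin.castSucc_lt_iff_succ_le.1 (not_le.1 hlt)) hy))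
  · have := s.isSimpleModule_factor i
    let U : Submodule A M := N ⊓ s i.succ
    let f : U →ₗ[A] s.Factor i := (Submodule.mkQ _) ∘ₗ Submodule.inclusion inf_le_right
    let g' : U →ₗ[A] S := g ∘ₗ Submodule.inclusion inf_le_left
    refine nonempty_linearEquiv_of_ker_le f g' ?_ ?_
    · intro h0
      exact hgy (LinearMap.congr_fun h0 ⟨y.1, y.2, hy⟩)
    · intro z hz
      refine hi ⟨z.1, z.2.1⟩ ?_
      simpa [f] using hz

end Factors

/-! ### Finite length of distributive modules over Artinian rings -/

section FiniteLength

variable {A : Type u} [Ring A]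

/-- Each simple submodule is a quotient of `A`, hence a factor of a fixed composition series of `A`.
Isomorphic simple submodules coincide, so `M` is a finite sum of simples. -/
lemma IsDistributiveModule.isNoetherian_of_isSemisimpleModule [IsArtinianRing A]
    {M : Type v} [AddCommGroup M] [Module A M] [IsSemisimpleModule A M]
    (h : IsDistributiveModule A M) : IsNoetherian A M := by
  obtain ⟨s, hs0, hs1⟩ := exists_compositionSeries_of_isNoetherian_isArtinian A A
  have hex : ∀ S : {S : Submodule A M // IsSimpleModule A S}, ∃ i : Fin s.length,
      Nonempty (s.Factor i ≃ₗ[A] S.1) := by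
    rintro ⟨S, hS⟩
    have := IsSimpleModule.nontrivial A S
    obtain ⟨x, hx⟩ := exists_ne (0 : S)
    obtain ⟨i, -, -, hi⟩ := s.exists_factor_linearEquiv ⊤
      ((LinearMap.toSpanSingleton A S x) ∘ₗ (⊤ : Submodule A A).subtype)
      (fun h0 ↦ hx (by simpa using LinearMap.congr_fun h0 ⟨1, trivial⟩)) 0 (Fin.last _)
      (le_of_eq hs1.symm) (fun y hy ↦ by
        have : (y : A) = 0 := by
          change (y : A) ∈ s.head at hy
          rwa [hs0, Submodule.mem_bot] at hy
        simp [this])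
    exact ⟨i, hi⟩
  choose f hf using hex
  have : Finite {S : Submodule A M // IsSimpleModule A S} := by
    refine Finite.of_injective f fun S T hST ↦ ?_
    have hS := S.2
    have hT := T.2
    obtain ⟨e⟩ := hf S
    obtain ⟨e'⟩ := hf T
    rw [← hST] at e'
    exact Subtype.ext (h.eq_of_linearEquiv (e.symm ≪≫ₗ e'))
  have htop : ⨆ S : {S : Submodule A M // IsSimpleModule A S}, S.1 = ⊤ := by
    rw [← IsSemisimpleModule.sSup_simples_eq_top A M, sSup_eq_iSup']
    rfl
  have hS : ∀ S : {S : Submodule A M // IsSimpleModule A S}, IsNoetherian A S.1 := fun S ↦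
    have := S.2
    inferInstance
  rw [← isNoetherian_top_iff, ← htop]
  exact isNoetherian_iSup

lemma IsDistributiveModule.isFiniteLength [IsArtinianRing A]
    {M : Type v} [AddCommGroup M] [Module A M] (h : IsDistributiveModule A M) :
    IsFiniteLength A M := by
  have hN : IsNoetherian A M := by
    revert h
    refine IsSemiprimaryRing.induction A A M
      (P := fun M ↦ IsDistributiveModule A M → IsNoetherian A M)
      (fun M _ _ _ _ _ _ h ↦ ?_) (fun M _ _ _ _ hs hq h ↦ ?_)
    · exact h.isNoetherian_of_isSemisimpleModule
    · rw [isNoetherian_iff_submodule_quotient (Ring.jacobson A • (⊤ : Submodule A M))]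
      exact ⟨hs (h.of_injective (Submodule.subtype _) Subtype.val_injective),
        hq (h.of_surjective (Submodule.mkQ _) (Submodule.mkQ_surjective _))⟩
  exact ((IsArtinianRing.tfae A M).out 1 3).1 hN

end FiniteLength

/-! ### Thin modules are distributive -/

section Thin

variable {A : Type u} [Ring A] {M : Type v} [AddCommGroup M] [Module A M]

lemma SupIrred.exists_covBy {L : Type*} [Lattice L] [WellFoundedGT L] {p : L} (hp : SupIrred p) :
    ∃ r, r ⋖ p ∧ ∀ q < p, q ≤ r := by
  obtain ⟨b, hb⟩ := not_isMin_iff.1 hp.1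
  obtain ⟨r, -, hr⟩ := exists_maximal_ge_of_wellFoundedGT (· < p) b hb
  have hle : ∀ q < p, q ≤ r := by
    intro q hq
    have hlt : q ⊔ r < p := lt_of_le_of_ne (sup_le hq.le hr.1.le) fun h ↦
      (hp.2 h).elim hq.ne hr.1.ne
    exact le_sup_left.trans (hr.2 hlt le_sup_right)
  exact ⟨r, ⟨hr.1, fun c hc hc' ↦ hc.not_ge (hle c hc')⟩, hle⟩

/-- Suppose `p ≤ X ⊔ Y` but `p` is below neither, and let `r` be the largest submodule strictly
inside `p`. The simple module `(X ⊔ p) / (X ⊔ r)` then occurs both above and below `Y` in a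
composition series through `Y`, contradicting thinness. -/
lemma IsThinModule.supPrime (h : IsThinModule A M) {p : Submodule A M} (hp : SupIrred p) :
    SupPrime p := by
  obtain ⟨hfl, hthin⟩ := h
  obtain ⟨_, _⟩ := isFiniteLength_iff_isNoetherian_isArtinian.1 hfl
  refine ⟨hp.1, fun X Y hXY ↦ ?_⟩
  by_contra! hcon
  obtain ⟨hX, hY⟩ := hcon
  obtain ⟨r, hr, hle⟩ := hp.exists_covBy
  have hlt : ∀ Z : Submodule A M, ¬ p ≤ Z → p ⊓ Z ≤ r := fun Z hZ ↦
    hle _ (lt_of_le_of_ne inf_le_left fun h' ↦ hZ (inf_eq_left.1 h'))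
  have hrX : (X ⊔ r) ⊓ p = r := by
    rw [sup_comm, sup_inf_assoc_of_le X hr.le, inf_comm X]
    exact sup_eq_left.2 (hlt X hX)
  have hcov : X ⊔ r ⋖ X ⊔ p := by
    have h1 : X ⊔ r ⋖ (X ⊔ r) ⊔ p := covBy_sup_of_inf_covBy_right (hrX.symm ▸ hr)
    rwa [sup_assoc, sup_eq_right.2 hr.le] at h1
  let S := (X ⊔ p : Submodule A M) ⧸ (X ⊔ r).comap (X ⊔ p).subtype
  have hS : IsSimpleModule A S := (covBy_iff_quot_is_simple hcov.le).1 hcov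
  have map : ∀ N : Submodule A M, N ≤ X ⊔ p → ¬ N ≤ X ⊔ r → ∃ g : N →ₗ[A] S, g ≠ 0 ∧
      ∀ x, g x = 0 ↔ (x : M) ∈ X ⊔ r := by
    intro N hN hN'
    have hg : ∀ x, ((Submodule.mkQ ((X ⊔ r).comap (X ⊔ p).subtype)) ∘ₗ
        Submodule.inclusion hN) x = 0 ↔ (x : M) ∈ X ⊔ r := by
      intro x
      simp
    refine ⟨_, fun h0 ↦ hN' fun x hx ↦ ?_, hg⟩
    exact (hg ⟨x, hx⟩).1 (by rw [h0]; rfl)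
  obtain ⟨s, hs0, hs1, a, rfl⟩ : ∃ s : CompositionSeries (Submodule A M), s.head = ⊥ ∧
      s.last = ⊤ ∧ ∃ a, s a = Y := by
    obtain ⟨t, i, hi, h0, h1⟩ := LTSeries.exists_relSeries_covBy_and_head_eq_bot_and_last_eq_bot
      (RelSeries.singleton _ Y)
    exact ⟨t, h0, h1, i 0, congrFun hi 0⟩
  -- Occurrence above `Y`: the map from `p` vanishes on `p ⊓ Y ≤ r`.
  obtain ⟨g, hg, hgker⟩ := map p le_sup_right fun h' ↦ hr.lt.not_ge (by
    rw [← hrX]; exact le_inf h' le_rfl)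
  obtain ⟨i, hai, -, ⟨e⟩⟩ := s.exists_factor_linearEquiv p g hg a (Fin.last _)
    (le_top.trans_eq hs1.symm) fun x hx ↦ (hgker x).2
      ((hlt _ hY).trans le_sup_right ⟨x.2, hx⟩)
  -- Occurrence below `Y`: by the modular law, `X` and `Y ⊓ (X ⊔ p)` span `X ⊔ p`, so the map from
  -- `Y ⊓ (X ⊔ p)` is nonzero.
  obtain ⟨g', hg', -⟩ := map (s a ⊓ (X ⊔ p)) inf_le_right fun h' ↦ by
    have h1 : X ⊔ (s a ⊓ (X ⊔ p)) = X ⊔ p := by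
      rw [← sup_inf_assoc_of_le (s a) (le_sup_left : X ≤ X ⊔ p)]
      exact inf_eq_right.2 (sup_le le_sup_left hXY)
    exact hcov.lt.not_ge (h1 ▸ sup_le le_sup_left h')
  obtain ⟨j, -, hja, ⟨e'⟩⟩ := s.exists_factor_linearEquiv _ g' hg' 0 a inf_le_left fun x hx ↦ by
    have : x = 0 := by
      change (x : M) ∈ s.head at hx
      rw [hs0, Submodule.mem_bot] at hx
      exact Subtype.ext hx
    simp [this]
  have hij := hthin s hs0 hs1 i j ⟨e ≪≫ₗ e'.symm⟩
  subst hij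
  exact (hja.trans hai).not_gt Fin.castSucc_lt_succ

lemma IsThinModule.isDistributiveModule (h : IsThinModule A M) : IsDistributiveModule A M := by
  obtain ⟨_, _⟩ := isFiniteLength_iff_isNoetherian_isArtinian.1 h.1
  intro X Y Z
  refine le_antisymm (le_iff_forall_supIrred_le.2 fun p hp hpX ↦ ?_)
    (sup_le (inf_le_inf_left _ le_sup_left) (inf_le_inf_left _ le_sup_right))
  rcases (h.supPrime hp).2 (hpX.trans inf_le_right) with hY | hZ
  · exact (le_inf (hpX.trans inf_le_left) hY).trans le_sup_left
  · exact (le_inf (hpX.trans inf_le_left) hZ).trans le_sup_right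

end Thin

/-! ### Induction on length -/

section Accessible

variable {A : Type u} [Ring A] {M : Type v} [AddCommGroup M] [Module A M]

lemma length_eq_add_quotient (N : Submodule A M) :
    Module.length A M = Module.length A N + Module.length A (M ⧸ N) :=
  Module.length_eq_add_of_exact N.subtype N.mkQ Subtype.val_injective N.mkQ_surjective
    (LinearMap.exact_subtype_mkQ N)

lemma isIndecomposableModule_quotient {a : Submodule A M} (ha : a ≠ ⊤)
    (h : ∀ X Y, X ⊓ Y = a → X ⊔ Y = ⊤ → X = a ∨ Y = a) :
    IsIndecomposableModule A (M ⧸ a) := by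
  refine ⟨Submodule.Quotient.nontrivial_iff.2 ha, fun X Y hXY ↦ ?_⟩
  have hbot : (⊥ : Submodule A (M ⧸ a)).comap a.mkQ = a := by
    rw [Submodule.comap_bot, Submodule.ker_mkQ]
  have hinj := Submodule.comap_injective_of_surjective a.mkQ_surjective
  rcases h (X.comap a.mkQ) (Y.comap a.mkQ)
    (by rw [← Submodule.comap_inf, hXY.inf_eq_bot, hbot])
    (by rw [← comap_sup_of_surjective a.mkQ_surjective, hXY.sup_eq_top, Submodule.comap_top])
    with h | h
  · exact Or.inl (hinj (h.trans hbot.symm))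
  · exact Or.inr (hinj (h.trans hbot.symm))

lemma isIndecomposableModule_submodule {c : Submodule A M} (hc : c ≠ ⊥)
    (h : ∀ X Y, X ⊓ Y = ⊥ → X ⊔ Y = c → X = ⊥ ∨ Y = ⊥) :
    IsIndecomposableModule A c := by
  refine ⟨(Submodule.nontrivial_iff_ne_bot).2 hc, fun X Y hXY ↦ ?_⟩
  have hinj := Submodule.map_injective_of_injective c.injective_subtype
  rcases h (X.map c.subtype) (Y.map c.subtype)
    (by rw [← Submodule.map_inf _ c.injective_subtype, hXY.inf_eq_bot, Submodule.map_bot])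
    (by rw [← Submodule.map_sup, hXY.sup_eq_top, Submodule.map_subtype_top])
    with h | h
  · exact Or.inl (hinj (h.trans (Submodule.map_bot _).symm))
  · exact Or.inr (hinj (h.trans (Submodule.map_bot _).symm))

lemma isSimpleModule_of_subsingleton_supIrred [Nontrivial M] [IsArtinian A M]
    (h : Subsingleton {p : Submodule A M // SupIrred p}) : IsSimpleModule A M := by
  rw [isSimpleModule_iff]
  refine { eq_bot_or_eq_top := fun X ↦ or_iff_not_imp_left.2 fun hX ↦ ?_ }
  obtain ⟨p, hp, hpX⟩ : ∃ p, SupIrred p ∧ p ≤ X := by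
    by_contra! hcon
    exact hX (le_bot_iff.1 (le_iff_forall_supIrred_le.2 fun p hp hpX ↦ (hcon p hp hpX).elim))
  refine top_le_iff.1 (le_iff_forall_supIrred_le.2 fun q hq _ ↦ ?_)
  exact (congrArg Subtype.val (h.elim ⟨q, hq⟩ ⟨p, hp⟩)).trans_le hpX

/-- Indecomposable distributive modules of finite length are accessible. -/
lemma IsDistributiveModule.isAccessibleModule (n : ℕ) : ∀ (M : Type v) [AddCommGroup M]
    [Module A M], Module.length A M = n → IsDistributiveModule A M →
      IsIndecomposableModule A M → IsAccessibleModule A M := by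
  induction n with
  | zero =>
    intro M _ _ hl _ hM
    have := hM.1
    exact absurd hl (Module.length_pos (R := A) (M := M)).ne'
  | succ n ih =>
    intro M _ _ hl hdist hM
    have := hM.1
    have hfl : IsFiniteLength A M := Module.length_ne_top_iff.1 (hl ▸ ENat.natCast_ne_top _)
    obtain ⟨_, _⟩ := isFiniteLength_iff_isNoetherian_isArtinian.1 hfl
    by_cases hs : IsSimpleModule A M
    · exact .simple M hs
    have hnt : Nontrivial {p : Submodule A M // SupIrred p} := by
      by_contra hcon
      exact hs (isSimpleModule_of_subsingleton_supIrred (not_nontrivial_iff_subsingleton.1 hcon))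
    have hone : ((1 : ℕ∞)) ≠ ⊤ := ENat.one_ne_top
    rcases exists_isAtom_or_isCoatom_of_indecomposable (fun p ↦ hdist.supPrime) hnt hM.2 with
      ⟨a, ha, hind⟩ | ⟨c, hc, hind⟩
    · have hsimple : IsSimpleModule A a := isSimpleModule_iff_isAtom.2 ha
      have hatop : a ≠ ⊤ := by
        rintro rfl
        exact hs (IsSimpleModule.congr Submodule.topEquiv.symm)
      have hla : Module.length A (M ⧸ a) = n := by
        have := length_eq_add_quotient a
        rw [hl, Module.length_eq_one A a, Nat.cast_succ] at this
        exact ((ENat.add_left_injective_of_ne_top hone) (this.trans (add_comm _ _))).symm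
      exact .of_quotient M n a hM hl hla
        (ih _ hla (hdist.of_surjective _ a.mkQ_surjective)
          (isIndecomposableModule_quotient hatop hind))
    · have hsimple : IsSimpleModule A (M ⧸ c) := isSimpleModule_iff_isCoatom.2 hc
      have hcbot : c ≠ ⊥ := by
        rintro rfl
        exact hs (IsSimpleModule.congr (Submodule.quotEquivOfEqBot ⊥ rfl).symm)
      have hlc : Module.length A c = n := by
        have := length_eq_add_quotient c
        rw [hl, Module.length_eq_one A (M ⧸ c), Nat.cast_succ] at this
        exact ((ENat.add_left_injective_of_ne_top hone) this).symm
      exact .of_submodule M n c hM hl hlc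
        (ih _ hlc (hdist.of_injective _ c.injective_subtype)
          (isIndecomposableModule_submodule hcbot hind))

end Accessible

/-- Thin modules are distributive, and distributive modules over Artinian rings have finite length, so
that both parts follow from `IsDistributiveModule.isAccessibleModule`. Acyclicity is not needed. -/
theorem theorem6 {K : Type*} [Field K] {A : Type u} [Ring A] [Algebra K A] [Module.Finite K A]
    {M : Type v} [AddCommGroup M] [Module A M] (hM : IsIndecomposableModule A M) :
    (IsAcyclicAlgebra A → IsDistributiveModule A M → IsAccessibleModule A M) ∧
      (IsThinModule A M → IsAccessibleModule A M) := by
  have : IsArtinianRing A := IsArtinianRing.of_finite K A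
  have key : IsDistributiveModule A M → IsAccessibleModule A M := fun h ↦ by
    obtain ⟨n, hn⟩ := ENat.ne_top_iff_exists.1 (Module.length_ne_top_iff.2 h.isFiniteLength)
    exact h.isAccessibleModule n M hn.symm hM
  exact ⟨fun _ ↦ key, fun h ↦ key h.isDistributiveModule⟩
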